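/- An alphabet is a finite set $\Sigma$; an automaton has a finite state set $Q$, an initial state and a transition function $\delta:Q\times\Sigma\to 2^Q$, and is deterministic if $|\delta(q,a)|\le 1$ for all $q,a$. A run on $w\in\Sigma^\omega$ is accepting for a Büchi condition $F\subseteq Q$ if it visits $F$ infinitely often; for a co-Büchi condition $F\subseteq Q$ if it visits $F$ only finitely often; for a Muller condition $\alpha\subseteq 2^Q$ if the set of states visited infinitely often is in $\alpha$; for a parity condition $\kappa:Q\to\{1,\dots,k\}$ if the minimal color visited infinitely often is odd. A word is accepted if it has an accepting run. Let $\mathbb{DB}$ (resp. $\mathbb{DC}$) be the class of $\omega$-languages $L\subseteq\Sigma^\omega$ accepted by a deterministic Büchi (resp. co-Büchi) automaton; the languages in $\mathbb{DB}\cap\mathbb{DC}$ are called weak. For $L\subseteq\Sigma^\omega$ and $x,y\in\Sigma^*$ let $x\sim_L y$ iff for all $w\in\Sigma^\omega$: $xw\in L\iff yw\in L$. The rightcon automaton $\mathcal R_L$ has the classes of $\sim_L$ as states, the initial state $[\epsilon]$ and the transitions $\delta([u],a)=[ua]$. Let $\mathbb{IM}$ (resp. $\mathbb{IP}$) be the class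 of $\omega$-languages $L$ such that $\mathcal R_L$ is isomorphic to (the underlying automaton of) a deterministic Muller (resp. parity) automaton accepting $L$. **Proposition.** $\mathbb{DB}\cap\mathbb{DC}\subsetneq\mathbb{IM}$ and $\mathbb{DB}\cap\mathbb{DC}\subsetneq\mathbb{IP}$. More precisely, both inclusions hold over every finite alphabet, and both are strict over every finite alphabet with at least two letters. Strictness is witnessed over $\Sigma=\{0,1\}$ by the deterministic automaton with states $\lambda$ (initial), $0$, $1$ and transitions $\lambda\xrightarrow{0}0$, $\lambda\xrightarrow{1}1$, $0\xrightarrow{0,1}\lambda$, $1\xrightarrow{0}1$, $1\xrightarrow{1}\lambda$. With the Muller condition $\{\{\lambda,1\}\}$ and with the parity condition $\kappa(0)=2$, $\kappa(\lambda)=3$, $\kappa(1)=4$ it accepts the same language $L$; it is isomorphic to $\mathcal R_L$; $L\in\mathbb{IM}\cap\mathbb{IP}$; $L\notin\mathbb{DB}\cap\mathbb{DC}$; and in the Muller automaton $\{1\}\subsetneq\{1,\lambda\}\subsetneq\{1,\lambda,0\}$ is an inclusion chain of SCCs (nonempty sets of states, not necessarily maximal, in which any two states are connected by a nonempty path inside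 the set) that are rejecting, accepting and rejecting, respectively, where an SCC is accepting if it belongs to the Muller condition. -/

import Mathlib

open Filter

universe u v w

/-- A (possibly nondeterministic, possibly incomplete) automaton with alphabet `A` and state
space `Q`. Finiteness of `A` and of `Q` is imposed where automata are used. -/
structure OmegaAutomaton (A : Type u) (Q : Type v) where
  /-- the initial state -/
  init : Q
  /-- the transition function -/
  step : Q → A → Set Q

namespace OmegaAutomaton

variable {A : Type u} {Q : Type v}

/-- At most one successor for every state and letter. -/
def Deterministic (M : OmegaAutomaton A Q) : Prop :=
  ∀ q a, (M.step q a).Subsingleton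

/-- `r` is a run of `M` on the infinite word `x`. -/
def IsRun (M : OmegaAutomaton A Q) (x : Stream' A) (r : ℕ → Q) : Prop :=
  r 0 = M.init ∧ ∀ n, r (n + 1) ∈ M.step (r n) (x.get n)

/-- The `ω`-language of `M` when `acc` is the set of accepting runs: the words that have at least
one accepting run. -/
def language (M : OmegaAutomaton A Q) (acc : Set (ℕ → Q)) : Set (Stream' A) :=
  {x | ∃ r, M.IsRun x r ∧ r ∈ acc}

/-- The set of states that occur infinitely often in `r`. -/
def infStates (r : ℕ → Q) : Set Q :=
  {q | {n | r n = q}.Infinite}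

/-- Büchi condition: `F` is visited infinitely often. -/
def buchi (F : Set Q) : Set (ℕ → Q) :=
  {r | {n | r n ∈ F}.Infinite}

/-- Co-Büchi condition: `F` is visited only finitely many times. -/
def coBuchi (F : Set Q) : Set (ℕ → Q) :=
  {r | {n | r n ∈ F}.Finite}

/-- Parity condition: the minimal color visited infinitely often is odd. -/
def parity (κ : Q → ℕ) : Set (ℕ → Q) :=
  {r | ∃ c, IsLeast (κ '' infStates r) c ∧ Odd c}

/-- Muller condition: the set of states visited infinitely often belongs to `α`. -/
def muller (α : Set (Set Q)) : Set (ℕ → Q) :=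
  {r | infStates r ∈ α}

/-- `κ` is a coloring with values in `[1..k]` for some `k`. -/
def IsColoring (κ : Q → ℕ) : Prop :=
  ∃ k, ∀ q, κ q ∈ Set.Icc 1 k

/-- An SCC, not required to be maximal: a nonempty set `S` of states such that any two states
`s`, `t` of `S` (also `s = t`) are connected by a path inside `S` with at least one transition. -/
def IsSCC (M : OmegaAutomaton A Q) (S : Set Q) : Prop :=
  S.Nonempty ∧ ∀ s ∈ S, ∀ t ∈ S,
    Relation.TransGen (fun p q => p ∈ S ∧ q ∈ S ∧ ∃ a, q ∈ M.step p a) s t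

/-- An isomorphism of automata: a bijection between the states that respects the initial states
and the transitions. -/
structure Iso {Q' : Type w} (M : OmegaAutomaton A Q) (N : OmegaAutomaton A Q') extends
    Q ≃ Q' where
  map_init : toEquiv M.init = N.init
  map_step : ∀ q a q', q' ∈ M.step q a ↔ toEquiv q' ∈ N.step (toEquiv q) a

end OmegaAutomaton

/-- The canonical right congruence of an `ω`-language `L` on finite words: `x ∼ y` iff for all
infinite words `z`, `xz ∈ L ↔ yz ∈ L`. -/
def rightCongruence {A : Type u} (L : Set (Stream' A)) : Setoid (List A) where
  r x y := ∀ z : Stream' A, x ++ₛ z ∈ L ↔ y ++ₛ z ∈ L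
  iseqv := ⟨fun _ _ => Iff.rfl, fun h z => (h z).symm, fun h₁ h₂ z => (h₁ z).trans (h₂ z)⟩

theorem rightCongruence_append {A : Type u} (L : Set (Stream' A)) (x y v : List A)
    (h : rightCongruence L x y) : rightCongruence L (x ++ v) (y ++ v) := by
  intro z
  rw [Stream'.append_append_stream, Stream'.append_append_stream]
  exact h (v ++ₛ z)

/-- The rightcon automaton of `L`: its states are the classes of the right congruence, its initial
state is the class of the empty word, and `δ([u], a) = [ua]`. -/
def rightconAutomaton {A : Type u} (L : Set (Stream' A)) :
    OmegaAutomaton A (Quotient (rightCongruence L)) where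
  init := Quotient.mk _ []
  step q a := {Quotient.map (fun x : List A => x ++ [a])
    (fun x y h => rightCongruence_append L x y [a] h) q}

open OmegaAutomaton

/-- Languages accepted by deterministic Büchi automata. -/
def DB (A : Type u) : Set (Set (Stream' A)) :=
  {L | ∃ (Q : Type) (_ : Finite Q) (M : OmegaAutomaton A Q) (F : Set Q),
    M.Deterministic ∧ M.language (buchi F) = L}

/-- Languages accepted by deterministic co-Büchi automata. -/
def DC (A : Type u) : Set (Set (Stream' A)) :=
  {L | ∃ (Q : Type) (_ : Finite Q) (M : OmegaAutomaton A Q) (F : Set Q),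
    M.Deterministic ∧ M.language (coBuchi F) = L}

/-- Languages whose rightcon automaton is isomorphic to a deterministic Muller automaton that
accepts the language. -/
def IM (A : Type u) : Set (Set (Stream' A)) :=
  {L | ∃ (Q : Type) (_ : Finite Q) (M : OmegaAutomaton A Q) (α : Set (Set Q)),
    M.Deterministic ∧ M.language (muller α) = L ∧ Nonempty (Iso (rightconAutomaton L) M)}

/-- Languages whose rightcon automaton is isomorphic to a deterministic parity automaton that
accepts the language. -/
def IP (A : Type u) : Set (Set (Stream' A)) :=
  {L | ∃ (Q : Type) (_ : Finite Q) (M : OmegaAutomaton A Q) (κ : Q → ℕ),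
    M.Deterministic ∧ IsColoring κ ∧ M.language (parity κ) = L ∧
      Nonempty (Iso (rightconAutomaton L) M)}

/-- The three states of the witness. -/
inductive PMState : Type
  | lam
  | zero
  | one

/-- The witness automaton, over the alphabet `{0, 1}`. -/
def pmAutomaton : OmegaAutomaton (Fin 2) PMState where
  init := .lam
  step
    | .lam, 0 => {.zero}
    | .lam, 1 => {.one}
    | .zero, 0 => {.lam}
    | .zero, 1 => {.lam}
    | .one, 0 => {.one}
    | .one, 1 => {.lam}

/-- The Muller condition of the witness. -/
def pmMuller : Set (Set PMState) :=
  {{.lam, .one}}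

/-- The parity condition of the witness. -/
def pmColor : PMState → ℕ
  | .zero => 2
  | .lam => 3
  | .one => 4

/-!
A deterministic Büchi language `L` is a limit of finite words: for a suitable set `p` of finite
words, an infinite word is in `L` iff infinitely many of its prefixes are in `p`. The complement of
a deterministic co-Büchi language is a limit in the same sense (`Deterministic.isLimitOf_buchi`,
`Deterministic.isLimitOf_compl_coBuchi`). Both halves of the proposition rest on one Baire-type
alternation argument, `exists_frequently_and_frequently`: if, within a set of finite words, every
word can be extended into `p` and also into `q`, then some infinite word has infinitely many
prefixes in `p` and infinitely many in `q`.

*Inclusion.* Let `L` be weak, so that `L` and its complement are both limits, and suppose that the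
runs of the rightcon automaton on `x ∈ L` and `y ∉ L` share a recurrent state `c`. A finite word in
the class `c` may be continued by the tail of `x` or by the tail of `y` with the same effect on
membership as after a prefix of `x` or `y` in `c`, and either tail returns to `c`. Alternation gives
a word both in `L` and outside `L`, a contradiction. So a single recurrent state decides membership
(`mem_iff_mem_of_common_class`), which yields both a Muller condition and a coloring with colors
`1` and `2` on the rightcon automaton; that automaton is finite because congruence is refined by
the set of states reached in a Büchi automaton for `L`.

*Strictness.* The witness accepts a word iff its run visits `λ` infinitely often and `0` finitely
often. From every state `1^ω` is accepted, and from every state `0` can be reached; if the language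
were a limit, alternation would produce an accepted word whose run visits `0` infinitely often
(`pmLanguage_notMem_DB`). The three states are separated by `(0011)^ω` after at most one letter, so
the witness is its own rightcon automaton (`nonempty_iso_pmPull`). All of this is done for the
witness read through a letter map `f : A → Fin 2` with a section `g`; larger alphabets take any such
`f`, and the identity gives the witness over `{0, 1}`.
-/

/-! ### Limit languages and alternation -/

/-- `L` is the limit of the set `p` of finite words: an infinite word belongs to `L` iff infinitely
many of its prefixes belong to `p`. These are the `Gδ` sets of infinite words. -/
def IsLimitOf {A : Type u} (L : Set (Stream' A)) (p : List A → Prop) : Prop :=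
  ∀ x, x ∈ L ↔ ∃ᶠ n in atTop, p (x.take n)

theorem exists_stream_of_chain {A : Type u} (s : ℕ → List A)
    (hs : ∀ n, s n <+: s (n + 1) ∧ (s n).length < (s (n + 1)).length) :
    ∃ x : Stream' A, ∀ n, x.take (s n).length = s n := by
  have hlen : ∀ n, n ≤ (s n).length := by
    intro n
    induction n with
    | zero => exact Nat.zero_le _
    | succ n ih => exact ih.trans_lt (hs n).2
  have hmono : ∀ m n, m ≤ n → s m <+: s n := by
    intro m n h
    induction h with
    | refl => exact List.prefix_rfl
    | step _ ih => exact ih.trans (hs _).1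
  let x : Stream' A := fun n => (s (n + 1))[n]'(hlen (n + 1))
  refine ⟨x, fun n => ?_⟩
  apply List.ext_getElem (by simp)
  intro i h₁ h₂
  rw [Stream'.take_get]
  change (s (i + 1))[i]'(hlen (i + 1)) = _
  rcases le_total (i + 1) n with h | h
  · exact (hmono _ _ h).getElem _
  · exact ((hmono _ _ h).getElem h₂).symm

/-- A Baire-type argument: if every word of `D` has a proper extension in `D` satisfying `p`, and
also one satisfying `q`, then alternating between the two yields an infinite word that has
infinitely many prefixes of either kind. -/
theorem exists_frequently_and_frequently {A : Type u} {D p q : List A → Prop} {z₀ : List A}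
    (h₀ : D z₀)
    (hp : ∀ z, D z → ∃ t, D t ∧ z <+: t ∧ z.length < t.length ∧ p t)
    (hq : ∀ z, D z → ∃ t, D t ∧ z <+: t ∧ z.length < t.length ∧ q t) :
    ∃ x : Stream' A, (∃ᶠ n in atTop, p (x.take n)) ∧ ∃ᶠ n in atTop, q (x.take n) := by
  choose! f hf using hp
  choose! g hg using hq
  obtain ⟨s, hzero, hsucc⟩ : ∃ s : ℕ → List A, s 0 = z₀ ∧
      ∀ n, s (n + 1) = if Even n then f (s n) else g (s n) :=
    ⟨fun n => n.rec z₀ fun k z => if Even k then f z else g z, rfl, fun _ => rfl⟩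
  have hD : ∀ n, D (s n) := by
    intro n
    induction n with
    | zero => exact hzero ▸ h₀
    | succ n ih =>
      rw [hsucc]
      split_ifs
      exacts [(hf _ ih).1, (hg _ ih).1]
  have hstep : ∀ n, s n <+: s (n + 1) ∧ (s n).length < (s (n + 1)).length := by
    intro n
    rw [hsucc]
    split_ifs
    exacts [⟨(hf _ (hD n)).2.1, (hf _ (hD n)).2.2.1⟩, ⟨(hg _ (hD n)).2.1, (hg _ (hD n)).2.2.1⟩]
  obtain ⟨x, hx⟩ := exists_stream_of_chain s hstep
  have hlen : ∀ n, n ≤ (s n).length := by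
    intro n
    induction n with
    | zero => exact Nat.zero_le _
    | succ n ih => exact ih.trans_lt (hstep n).2
  refine ⟨x, frequently_atTop.2 fun N => ⟨(s (2 * N + 1)).length, ?_, ?_⟩,
    frequently_atTop.2 fun N => ⟨(s (2 * N + 1 + 1)).length, ?_, ?_⟩⟩
  · have := hlen (2 * N + 1)
    lia
  · rw [hx, hsucc, if_pos (by simp)]
    exact (hf _ (hD _)).2.2.2
  · have := hlen (2 * N + 1 + 1)
    lia
  · rw [hx, hsucc, if_neg (by simp)]
    exact (hg _ (hD _)).2.2.2

/-- If the prefixes of an infinite extension of `z` all lie in `D` and infinitely many of them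
satisfy `p`, then `z` has a proper extension in `D` satisfying `p`. -/
theorem exists_extension_of_frequently {A : Type u} {D p : List A → Prop} {z : List A}
    {y : Stream' A} (hD : ∀ n, D (y.take n)) (hz : y.take z.length = z)
    (hp : ∃ᶠ n in atTop, p (y.take n)) :
    ∃ t, D t ∧ z <+: t ∧ z.length < t.length ∧ p t := by
  obtain ⟨n, hn, hpn⟩ := frequently_atTop.1 hp (z.length + 1)
  refine ⟨y.take n, hD n, ?_, by rw [Stream'.length_take]; lia, hpn⟩
  rw [← hz]
  exact (Stream'.take_prefix _ _ _).2 (by lia)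

theorem take_length_append {A : Type u} (z : List A) (y : Stream' A) :
    (z ++ₛ y).take z.length = z := by
  rw [Stream'.take_append_of_le_length _ _ _ le_rfl, List.take_length]

theorem frequently_take_append {A : Type u} (p : List A → Prop) (z : List A) (y : Stream' A) :
    (∃ᶠ n in atTop, p ((z ++ₛ y).take n)) ↔ ∃ᶠ n in atTop, p (z ++ y.take n) := by
  simp_rw [Stream'.append_take]
  conv_lhs => rw [← map_add_atTop_eq_nat z.length, frequently_map]
  simp_rw [Nat.add_comm _ z.length]

/-! ### Deterministic automata and the sets of states they reach -/

namespace OmegaAutomaton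

variable {A : Type u} {Q : Type v}

/-- The states that `M` can reach by reading the finite word `z`. -/
def reach (M : OmegaAutomaton A Q) (z : List A) : Set Q :=
  z.foldl (fun S a => ⋃ q ∈ S, M.step q a) {M.init}

theorem reach_append_singleton (M : OmegaAutomaton A Q) (z : List A) (a : A) :
    M.reach (z ++ [a]) = ⋃ q ∈ M.reach z, M.step q a := by
  simp [reach]

theorem reach_append_congr (M : OmegaAutomaton A Q) {y z : List A} (h : M.reach y = M.reach z)
    (t : List A) : M.reach (y ++ t) = M.reach (z ++ t) := by
  unfold reach at *
  rw [List.foldl_append, List.foldl_append, h]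

theorem Deterministic.subsingleton_reach {M : OmegaAutomaton A Q} (hM : M.Deterministic)
    (z : List A) : (M.reach z).Subsingleton := by
  induction z using List.reverseRecOn with
  | nil => exact Set.subsingleton_singleton
  | append_singleton z a ih =>
    rw [reach_append_singleton]
    rcases ih.eq_empty_or_singleton with h | ⟨q, h⟩
    · simp [h]
    · simpa [h] using hM q a

theorem nonempty_reach_of_append (M : OmegaAutomaton A Q) (z t : List A)
    (h : (M.reach (z ++ t)).Nonempty) : (M.reach z).Nonempty := by
  induction t using List.reverseRecOn with
  | nil => simpa using h
  | append_singleton t a ih =>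
    rw [← List.append_assoc, reach_append_singleton] at h
    obtain ⟨q, hq⟩ := h
    simp only [Set.mem_iUnion] at hq
    obtain ⟨q', hq', -⟩ := hq
    exact ih ⟨q', hq'⟩

theorem IsRun.mem_reach {M : OmegaAutomaton A Q} {x : Stream' A} {r : ℕ → Q} (hr : M.IsRun x r)
    (n : ℕ) : r n ∈ M.reach (x.take n) := by
  induction n with
  | zero => exact hr.1
  | succ n ih =>
    rw [Stream'.take_succ', reach_append_singleton]
    exact Set.mem_biUnion ih (hr.2 n)

theorem Deterministic.exists_isRun {M : OmegaAutomaton A Q} (hM : M.Deterministic)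
    {x : Stream' A} (h : ∃ᶠ n in atTop, (M.reach (x.take n)).Nonempty) : ∃ r, M.IsRun x r := by
  have h' : ∀ n, (M.reach (x.take n)).Nonempty := by
    intro n
    obtain ⟨m, hm, hne⟩ := frequently_atTop.1 h n
    obtain ⟨k, rfl⟩ := Nat.exists_eq_add_of_le hm
    rw [Stream'.take_add] at hne
    exact M.nonempty_reach_of_append _ _ hne
  choose r hr using h'
  refine ⟨r, hr 0, fun n => ?_⟩
  have hmem := hr (n + 1)
  rw [Stream'.take_succ', reach_append_singleton] at hmem
  simp only [Set.mem_iUnion] at hmem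
  obtain ⟨q, hq, hq'⟩ := hmem
  rwa [hM.subsingleton_reach _ (hr n) hq]

theorem Deterministic.isLimitOf_buchi {M : OmegaAutomaton A Q} (hM : M.Deterministic)
    (F : Set Q) : IsLimitOf (M.language (buchi F)) fun z => ∃ q ∈ M.reach z, q ∈ F := by
  intro x
  constructor
  · rintro ⟨r, hr, hF⟩
    exact (Nat.frequently_atTop_iff_infinite.2 hF).mono fun n hn => ⟨r n, hr.mem_reach n, hn⟩
  · intro h
    obtain ⟨r, hr⟩ := hM.exists_isRun (h.mono fun n ⟨q, hq, _⟩ => ⟨q, hq⟩)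
    refine ⟨r, hr, Nat.frequently_atTop_iff_infinite.1 (h.mono fun n ⟨q, hq, hqF⟩ => ?_)⟩
    rwa [hM.subsingleton_reach _ (hr.mem_reach n) hq]

/-- The complement of a deterministic co-Büchi language is a limit. Reading `⊆` covers the words
on which the automaton gets stuck, since then the reached set is eventually empty. -/
theorem Deterministic.isLimitOf_compl_coBuchi {M : OmegaAutomaton A Q} (hM : M.Deterministic)
    (F : Set Q) : IsLimitOf (M.language (coBuchi F))ᶜ fun z => M.reach z ⊆ F := by
  intro x
  constructor
  · intro h
    by_cases hne : ∃ᶠ n in atTop, (M.reach (x.take n)).Nonempty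
    · obtain ⟨r, hr⟩ := hM.exists_isRun hne
      have hF : {n | r n ∈ F}.Infinite := fun hfin => h ⟨r, hr, hfin⟩
      refine (Nat.frequently_atTop_iff_infinite.2 hF).mono fun n hn q hq => ?_
      rwa [hM.subsingleton_reach _ hq (hr.mem_reach n)]
    · refine ((not_frequently.1 hne).mono fun n hn => ?_).frequently
      exact (Set.not_nonempty_iff_eq_empty.1 hn).subset.trans (Set.empty_subset F)
  · rintro h ⟨r, hr, hfin⟩
    exact Nat.frequently_atTop_iff_infinite.1 (h.mono fun n hn => hn (hr.mem_reach n)) hfin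

end OmegaAutomaton

theorem exists_isLimitOf_of_mem_DB {A : Type u} {L : Set (Stream' A)} (hL : L ∈ DB A) :
    ∃ p, IsLimitOf L p := by
  obtain ⟨Q, _, M, F, hM, rfl⟩ := hL
  exact ⟨_, hM.isLimitOf_buchi F⟩

theorem exists_isLimitOf_compl_of_mem_DC {A : Type u} {L : Set (Stream' A)} (hL : L ∈ DC A) :
    ∃ p, IsLimitOf Lᶜ p := by
  obtain ⟨Q, _, M, F, hM, rfl⟩ := hL
  exact ⟨_, hM.isLimitOf_compl_coBuchi F⟩

/-- Words reaching the same set of states are congruent, so there are finitely many classes. -/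
theorem finite_quotient_of_mem_DB {A : Type u} {L : Set (Stream' A)} (hL : L ∈ DB A) :
    Finite (Quotient (rightCongruence L)) := by
  obtain ⟨Q, _, M, F, hM, rfl⟩ := hL
  refine Finite.of_injective (fun c => M.reach c.out) fun c d h => ?_
  rw [← c.out_eq, ← d.out_eq]
  refine Quotient.sound fun z => ?_
  rw [hM.isLimitOf_buchi, hM.isLimitOf_buchi,
    frequently_take_append fun z => ∃ q ∈ M.reach z, q ∈ F,
    frequently_take_append fun z => ∃ q ∈ M.reach z, q ∈ F]
  simp_rw [M.reach_append_congr h]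

/-! ### Weak languages and their right congruence -/

section Weak

variable {A : Type u} {L : Set (Stream' A)}

/-- If the prefixes of `x` meet the class `c` again and again, then every word `z` that can be
continued into `c` extends to an infinite word on which `L` decides as on `x`, and all of whose
prefixes can be continued into `c`. -/
theorem exists_extension_of_recurrent {c : Quotient (rightCongruence L)} {x : Stream' A}
    (hx : ∃ᶠ n in atTop, (⟦x.take n⟧ : Quotient (rightCongruence L)) = c) {z v : List A}
    (hz : (⟦z ++ v⟧ : Quotient (rightCongruence L)) = c) :
    ∃ y : Stream' A, (y ∈ L ↔ x ∈ L) ∧ y.take z.length = z ∧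
      ∀ n, ∃ t, (⟦y.take n ++ t⟧ : Quotient (rightCongruence L)) = c := by
  obtain ⟨k, hk⟩ := hx.exists
  have hcong : rightCongruence L (z ++ v) (x.take k) := Quotient.exact (hz.trans hk.symm)
  refine ⟨(z ++ v) ++ₛ x.drop k, ?_, ?_, fun n => ?_⟩
  · rw [hcong, Stream'.append_take_drop]
  · rw [Stream'.append_append_stream, take_length_append]
  · obtain ⟨m, hm, hmc⟩ := frequently_atTop.1 hx (k + n)
    obtain ⟨i, rfl⟩ := Nat.exists_eq_add_of_le (le_of_add_le_left hm)
    have hle : n ≤ (z ++ v).length + i := by lia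
    obtain ⟨j, hj⟩ := Nat.exists_eq_add_of_le hle
    refine ⟨(((z ++ v) ++ₛ x.drop k).drop n).take j, ?_⟩
    rw [← Stream'.take_add, ← hj, ← Stream'.append_take, ← hmc, Stream'.take_add]
    exact Quotient.sound (rightCongruence_append L _ _ _ hcong)

/-- A weak language decides alike on any two words whose runs in the rightcon automaton share a
recurrent state: otherwise, alternating between segments of the two words, one would obtain an
infinite word that is both in the language and in its complement. -/
theorem mem_iff_mem_of_common_class (hB : L ∈ DB A) (hC : L ∈ DC A)
    {c : Quotient (rightCongruence L)} {x y : Stream' A}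
    (hx : ∃ᶠ n in atTop, (⟦x.take n⟧ : Quotient (rightCongruence L)) = c)
    (hy : ∃ᶠ n in atTop, (⟦y.take n⟧ : Quotient (rightCongruence L)) = c) :
    x ∈ L ↔ y ∈ L := by
  obtain ⟨p, hp⟩ := exists_isLimitOf_of_mem_DB hB
  obtain ⟨q, hq⟩ := exists_isLimitOf_compl_of_mem_DC hC
  suffices H : ∀ {x y : Stream' A},
      (∃ᶠ n in atTop, (⟦x.take n⟧ : Quotient (rightCongruence L)) = c) →
      (∃ᶠ n in atTop, (⟦y.take n⟧ : Quotient (rightCongruence L)) = c) → x ∈ L → y ∈ L from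
    ⟨H hx hy, H hy hx⟩
  intro x y hx hy hxL
  by_contra hyL
  obtain ⟨k, hk⟩ := hx.exists
  obtain ⟨w, hwp, hwq⟩ := exists_frequently_and_frequently
    (D := fun z => ∃ v, (⟦z ++ v⟧ : Quotient (rightCongruence L)) = c) (p := p) (q := q)
    (z₀ := x.take k) ⟨[], by simpa using hk⟩
    (fun z ⟨v, hv⟩ => by
      obtain ⟨x', hx', hz, hD⟩ := exists_extension_of_recurrent hx hv
      exact exists_extension_of_frequently hD hz ((hp x').1 (hx'.2 hxL)))
    (fun z ⟨v, hv⟩ => by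
      obtain ⟨y', hy', hz, hD⟩ := exists_extension_of_recurrent hy hv
      exact exists_extension_of_frequently hD hz ((hq y').1 fun h => hyL (hy'.1 h)))
  exact (hq w).2 hwq ((hp w).2 hwp)

end Weak

/-! ### Transport along bijections of the states -/

namespace OmegaAutomaton

variable {A : Type u} {Q : Type v} {Q' : Type w}

/-- The automaton obtained from `M` by renaming the states along the bijection `e`. -/
def rename (M : OmegaAutomaton A Q) (e : Q ≃ Q') : OmegaAutomaton A Q' where
  init := e M.init
  step q a := e '' M.step (e.symm q) a

/-- Renaming the states is an isomorphism. -/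
def renameIso (M : OmegaAutomaton A Q) (e : Q ≃ Q') : Iso M (M.rename e) where
  toEquiv := e
  map_init := rfl
  map_step q a q' := by simp [rename]

theorem Deterministic.rename {M : OmegaAutomaton A Q} (hM : M.Deterministic) (e : Q ≃ Q') :
    (M.rename e).Deterministic :=
  fun q a => (hM (e.symm q) a).image e

theorem rename_isRun (M : OmegaAutomaton A Q) (e : Q ≃ Q') (x : Stream' A) (r : ℕ → Q') :
    (M.rename e).IsRun x r ↔ M.IsRun x (e.symm ∘ r) := by
  simp only [IsRun, OmegaAutomaton.rename, Function.comp_apply, Equiv.symm_apply_eq,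
    e.image_eq_preimage_symm, Set.mem_preimage]

theorem rename_language (M : OmegaAutomaton A Q) (e : Q ≃ Q') (acc : Set (ℕ → Q)) :
    (M.rename e).language {r | e.symm ∘ r ∈ acc} = M.language acc := by
  ext x
  constructor
  · rintro ⟨r, hr, hacc⟩
    exact ⟨_, (M.rename_isRun e x r).1 hr, hacc⟩
  · rintro ⟨r, hr, hacc⟩
    have h : e.symm ∘ e ∘ r = r := by
      ext
      simp
    refine ⟨e ∘ r, (M.rename_isRun e x _).2 (h.symm ▸ hr), ?_⟩
    rwa [Set.mem_ofPred_eq, h]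

theorem infStates_equiv_comp (e : Q ≃ Q') (r : ℕ → Q) :
    infStates (e ∘ r) = e '' infStates r := by
  ext q
  simp [infStates, e.image_eq_preimage_symm, ← Equiv.eq_symm_apply]

theorem mem_infStates_iff_frequently {r : ℕ → Q} {q : Q} :
    q ∈ infStates r ↔ ∃ᶠ n in atTop, r n = q :=
  Nat.frequently_atTop_iff_infinite.symm

theorem infStates_nonempty [Finite Q] (r : ℕ → Q) : (infStates r).Nonempty := by
  obtain ⟨q, hq⟩ := Finite.exists_infinite_fiber r
  exact ⟨q, Set.infinite_coe_iff.1 hq⟩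

end OmegaAutomaton

/-! ### Acceptance on the rightcon automaton -/

section Rightcon

variable {A : Type u} {L : Set (Stream' A)}

theorem rightconAutomaton_deterministic (L : Set (Stream' A)) :
    (rightconAutomaton L).Deterministic :=
  fun _ _ => Set.subsingleton_singleton

theorem rightconAutomaton_isRun_iff {x : Stream' A} {r : ℕ → Quotient (rightCongruence L)} :
    (rightconAutomaton L).IsRun x r ↔ r = fun n => ⟦x.take n⟧ := by
  have hstep : ∀ n, (⟦x.take (n + 1)⟧ : Quotient (rightCongruence L)) ∈
      (rightconAutomaton L).step ⟦x.take n⟧ (x.get n) := by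
    intro n
    rw [Stream'.take_succ']
    rfl
  constructor
  · rintro ⟨h₀, h⟩
    funext n
    induction n with
    | zero => exact h₀
    | succ n ih => exact rightconAutomaton_deterministic L _ _ (h n) (ih ▸ hstep n)
  · rintro rfl
    exact ⟨rfl, hstep⟩

theorem mem_language_rightconAutomaton {x : Stream' A}
    {acc : Set (ℕ → Quotient (rightCongruence L))} :
    x ∈ (rightconAutomaton L).language acc ↔ (fun n => ⟦x.take n⟧) ∈ acc := by
  simp [language, rightconAutomaton_isRun_iff]

theorem mem_IM_of_rightconAutomaton [Finite (Quotient (rightCongruence L))]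
    (α : Set (Set (Quotient (rightCongruence L))))
    (h : (rightconAutomaton L).language (muller α) = L) : L ∈ IM A := by
  obtain ⟨n, ⟨e⟩⟩ := Finite.exists_equiv_fin (Quotient (rightCongruence L))
  refine ⟨Fin n, inferInstance, (rightconAutomaton L).rename e, {S | e.symm '' S ∈ α},
    (rightconAutomaton_deterministic L).rename e, ?_, ⟨renameIso _ e⟩⟩
  conv_rhs => rw [← h, ← rename_language _ e]
  congr 1
  ext r
  simp only [muller, Set.mem_ofPred_eq, infStates_equiv_comp]

theorem mem_IP_of_rightconAutomaton [Finite (Quotient (rightCongruence L))]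
    (κ : Quotient (rightCongruence L) → ℕ) (hκ : IsColoring κ)
    (h : (rightconAutomaton L).language (parity κ) = L) : L ∈ IP A := by
  obtain ⟨n, ⟨e⟩⟩ := Finite.exists_equiv_fin (Quotient (rightCongruence L))
  refine ⟨Fin n, inferInstance, (rightconAutomaton L).rename e, κ ∘ e.symm,
    (rightconAutomaton_deterministic L).rename e, hκ.imp fun k hk q => hk _, ?_,
    ⟨renameIso _ e⟩⟩
  conv_rhs => rw [← h, ← rename_language _ e]
  congr 1
  ext r
  simp only [parity, Set.mem_ofPred_eq, infStates_equiv_comp, Set.image_comp]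

/-- Since one recurrent state decides membership, so does the set of all of them: the sets arising
from the words of the language form the Muller condition. -/
theorem DB_inter_DC_subset_IM (A : Type u) : DB A ∩ DC A ⊆ IM A := by
  rintro L ⟨hB, hC⟩
  have := finite_quotient_of_mem_DB hB
  let run (x : Stream' A) : ℕ → Quotient (rightCongruence L) := fun n => ⟦x.take n⟧
  refine mem_IM_of_rightconAutomaton ((fun x => infStates (run x)) '' L) ?_
  ext x
  rw [mem_language_rightconAutomaton]
  constructor
  · rintro ⟨y, hyL, hy⟩
    obtain ⟨c, hc⟩ := infStates_nonempty (run x)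
    have hcy : c ∈ infStates (run y) := hy.superset hc
    exact (mem_iff_mem_of_common_class hB hC (mem_infStates_iff_frequently.1 hcy)
      (mem_infStates_iff_frequently.1 hc)).1 hyL
  · exact fun hx => ⟨x, hx, rfl⟩

open Classical in
/-- The states that are recurrent for some word of the language get color `1`, all others color
`2`; all recurrent states of a given word then have the same color. -/
theorem DB_inter_DC_subset_IP (A : Type u) : DB A ∩ DC A ⊆ IP A := by
  rintro L ⟨hB, hC⟩
  have := finite_quotient_of_mem_DB hB
  let run (x : Stream' A) : ℕ → Quotient (rightCongruence L) := fun n => ⟦x.take n⟧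
  let κ (c : Quotient (rightCongruence L)) : ℕ := if ∃ x ∈ L, c ∈ infStates (run x) then 1 else 2
  have hκ : ∀ x, ∀ c ∈ infStates (run x), κ c = if x ∈ L then 1 else 2 := by
    intro x c hc
    refine if_congr ⟨fun ⟨y, hyL, hy⟩ => ?_, fun hx => ⟨x, hx, hc⟩⟩ rfl rfl
    exact (mem_iff_mem_of_common_class hB hC (mem_infStates_iff_frequently.1 hy)
      (mem_infStates_iff_frequently.1 hc)).1 hyL
  refine mem_IP_of_rightconAutomaton κ ⟨2, fun c => ?_⟩ ?_
  · by_cases h : ∃ x ∈ L, c ∈ infStates (run x) <;> simp [κ, h]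
  · ext x
    have himage : κ '' infStates (run x) = {if x ∈ L then 1 else 2} := by
      rw [Set.image_congr (hκ x), (infStates_nonempty (run x)).image_const]
    rw [mem_language_rightconAutomaton]
    change (∃ c, IsLeast (κ '' infStates (run x)) c ∧ Odd c) ↔ _
    by_cases hx : x ∈ L
    · simpa only [himage, hx, if_true, iff_true] using ⟨1, isLeast_singleton, odd_one⟩
    · simp only [himage, hx, if_false, iff_false]
      rintro ⟨c, ⟨rfl, -⟩, hodd⟩
      exact absurd hodd (by decide)

end Rightcon

/-! ### The three-state witness over an arbitrary alphabet -/

/-- The transition function of the witness. -/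
def pmStep (q : PMState) (a : Fin 2) : PMState :=
  match q, a with
  | .lam, 0 => .zero
  | .lam, 1 => .one
  | .zero, _ => .lam
  | .one, 0 => .one
  | .one, 1 => .lam

/-- The witness read through a letter map `f`: a letter `a` acts as `f a`. -/
def pmPull {A : Type u} (f : A → Fin 2) : OmegaAutomaton A PMState where
  init := .lam
  step q a := pmAutomaton.step q (f a)

instance : Finite PMState :=
  Finite.of_injective (fun q => match q with | .lam => 0 | .zero => 1 | .one => 2 : PMState → Fin 3)
    (by intro p q; cases p <;> cases q <;> simp)

section Witness

variable {A : Type u} (f : A → Fin 2)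

theorem pmPull_step (q : PMState) (a : A) : (pmPull f).step q a = {pmStep q (f a)} := by
  change pmAutomaton.step q (f a) = _
  generalize f a = b
  cases q <;> fin_cases b <;> rfl

theorem pmPull_deterministic : (pmPull f).Deterministic := by
  intro q a
  rw [pmPull_step]
  exact Set.subsingleton_singleton

/-- The run of the witness on `z` that starts in `q`. -/
def pmRun (q : PMState) (z : Stream' A) : ℕ → PMState
  | 0 => q
  | n + 1 => pmStep (pmRun q z n) (f (z.get n))

/-- The state that the witness reaches by reading `x`. -/
def pmState (x : List A) : PMState :=
  x.foldl (fun q a => pmStep q (f a)) .lam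

theorem pmPull_isRun_iff {x : Stream' A} {r : ℕ → PMState} :
    (pmPull f).IsRun x r ↔ r = pmRun f .lam x := by
  simp only [IsRun, pmPull_step, Set.mem_singleton_iff]
  constructor
  · rintro ⟨h₀, h⟩
    funext n
    induction n with
    | zero => exact h₀
    | succ n ih => rw [h, ih]; rfl
  · rintro rfl
    exact ⟨rfl, fun _ => rfl⟩

theorem pmRun_eq_pmState (x : Stream' A) (n : ℕ) : pmRun f .lam x n = pmState f (x.take n) := by
  induction n with
  | zero => rfl
  | succ n ih =>
    rw [Stream'.take_succ', pmState, List.foldl_append]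
    change pmStep _ _ = pmStep _ _
    rw [ih]
    rfl

theorem pmRun_append (x : List A) (z : Stream' A) (n : ℕ) :
    pmRun f .lam (x ++ₛ z) (n + x.length) = pmRun f (pmState f x) z n := by
  induction n with
  | zero => rw [Nat.zero_add, pmRun_eq_pmState, take_length_append]; rfl
  | succ n ih =>
    rw [Nat.add_right_comm]
    change pmStep _ (f ((x ++ₛ z).get (n + x.length))) = pmStep _ _
    rw [ih, Nat.add_comm, Stream'.get_append_right]

/-- Acceptance of a run by the witness: `λ` recurs and `0` does not. -/
def PMAccepts (r : ℕ → PMState) : Prop :=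
  (∃ᶠ n in atTop, r n = .lam) ∧ ¬ ∃ᶠ n in atTop, r n = .zero

theorem pmAccepts_comp_add (r : ℕ → PMState) (k : ℕ) :
    PMAccepts (fun n => r (n + k)) ↔ PMAccepts r := by
  have h : ∀ q, (∃ᶠ n in atTop, r (n + k) = q) ↔ ∃ᶠ n in atTop, r n = q := by
    intro q
    conv_rhs => rw [← map_add_atTop_eq_nat k, frequently_map]
  simp only [PMAccepts, h]

theorem pmRun_mem_muller (x : Stream' A) (q : PMState) :
    pmRun f q x ∈ muller pmMuller ↔ PMAccepts (pmRun f q x) := by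
  have hlam : (∃ᶠ n in atTop, pmRun f q x n = .lam) →
      (¬ ∃ᶠ n in atTop, pmRun f q x n = .zero) → ∃ᶠ n in atTop, pmRun f q x n = .one := by
    intro h₁ h₂
    rw [not_frequently] at h₂
    -- the state after `λ` is `0` or `1`
    have h₃ := h₁.and_eventually ((tendsto_add_atTop_nat 1).eventually h₂)
    refine (tendsto_add_atTop_nat 1).frequently (h₃.mono fun n ⟨hn, hn'⟩ => ?_)
    change pmStep (pmRun f q x n) (f (x.get n)) ≠ _ at hn'
    change pmStep (pmRun f q x n) (f (x.get n)) = _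
    rw [hn] at hn' ⊢
    generalize f (x.get n) = b at *
    fin_cases b
    · exact absurd rfl hn'
    · rfl
  simp only [muller, pmMuller, Set.mem_ofPred_eq, Set.mem_singleton_iff, PMAccepts]
  simp only [← mem_infStates_iff_frequently] at hlam ⊢
  constructor
  · intro h
    simp [h]
  · rintro ⟨h₁, h₂⟩
    ext s
    cases s <;> simp [h₁, h₂, hlam h₁ h₂]

theorem pmRun_mem_parity (x : Stream' A) (q : PMState) :
    pmRun f q x ∈ parity pmColor ↔ PMAccepts (pmRun f q x) := by
  simp only [parity, Set.mem_ofPred_eq, PMAccepts, ← mem_infStates_iff_frequently]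
  constructor
  · rintro ⟨c, ⟨⟨s, hs, rfl⟩, hmin⟩, hodd⟩
    cases s with
    | lam => exact ⟨hs, fun h => absurd (hmin ⟨_, h, rfl⟩) (by decide)⟩
    | zero => exact absurd hodd (by decide)
    | one => exact absurd hodd (by decide)
  · rintro ⟨h₁, h₂⟩
    refine ⟨3, ⟨⟨_, h₁, rfl⟩, ?_⟩, by decide⟩
    rintro _ ⟨s, hs, rfl⟩
    cases s with
    | lam => decide
    | zero => exact absurd hs h₂
    | one => decide

/-- The language of the witness read through `f`. -/
abbrev pmLanguage : Set (Stream' A) :=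
  (pmPull f).language (muller pmMuller)

variable {f}

theorem mem_pmLanguage_iff {x : Stream' A} : x ∈ pmLanguage f ↔ PMAccepts (pmRun f .lam x) := by
  simp only [language, pmPull_isRun_iff, Set.mem_ofPred_eq, exists_eq_left, pmRun_mem_muller]

theorem pmLanguage_eq_parity : pmLanguage f = (pmPull f).language (parity pmColor) := by
  ext x
  rw [mem_pmLanguage_iff]
  simp only [language, pmPull_isRun_iff, Set.mem_ofPred_eq, exists_eq_left, pmRun_mem_parity]

theorem append_mem_pmLanguage_iff {x : List A} {z : Stream' A} :
    x ++ₛ z ∈ pmLanguage f ↔ PMAccepts (pmRun f (pmState f x) z) := by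
  rw [mem_pmLanguage_iff, ← pmAccepts_comp_add _ x.length]
  simp only [pmRun_append]

theorem pmRun_eq_of_step {z : Stream' A} {r : ℕ → PMState}
    (h : ∀ n, r (n + 1) = pmStep (r n) (f (z.get n))) : pmRun f (r 0) z = r := by
  funext n
  induction n with
  | zero => rfl
  | succ n ih => rw [h, ← ih]; rfl

/-- The form in which periodic runs are accepted: from position `i` on, `0` is absent and `λ` occurs
every `k` steps. -/
theorem pmAccepts_of_period {r : ℕ → PMState} {k i : ℕ} (hk : 0 < k)
    (hlam : ∀ n, r (k * n + i) = .lam) (hzero : ∀ n, r (n + i) ≠ .zero) : PMAccepts r := by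
  refine ⟨frequently_atTop.2 fun N => ⟨k * N + i, ?_, hlam N⟩, ?_⟩
  · exact (Nat.le_mul_of_pos_left N hk).trans (Nat.le_add_right _ _)
  · rw [not_frequently]
    filter_upwards [eventually_ge_atTop i] with n hn
    obtain ⟨m, rfl⟩ := Nat.exists_eq_add_of_le hn
    rw [Nat.add_comm]
    exact hzero m

end Witness

/-! ### Words that separate the states of the witness, and strictness -/

section WitnessStates

variable {A : Type u} {f : A → Fin 2} {g : Fin 2 → A}

theorem pmAccepts_const (hg : ∀ i, f (g i) = i) (q : PMState) :
    PMAccepts (pmRun f q (Stream'.const (g 1))) := by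
  have hconst : ∀ n, f ((Stream'.const (g 1)).get n) = 1 := fun _ => hg 1
  cases q with
  | lam =>
    let r : ℕ → PMState := fun n => if n % 2 = 0 then .lam else .one
    have hr : pmRun f .lam (Stream'.const (g 1)) = r := by
      refine pmRun_eq_of_step (r := r) fun n => ?_
      rw [hconst]
      rcases Nat.mod_two_eq_zero_or_one n with h | h <;> simp [r, h, Nat.add_mod, pmStep]
    rw [hr]
    refine pmAccepts_of_period (k := 2) (i := 0) two_pos (fun n => by simp [r]) fun n => ?_
    simp only [r]
    split_ifs <;> simp
  | zero =>
    let r : ℕ → PMState := fun n => if n = 0 then .zero else if n % 2 = 1 then .lam else .one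
    have hr : pmRun f .zero (Stream'.const (g 1)) = r := by
      refine pmRun_eq_of_step (r := r) fun n => ?_
      rw [hconst]
      rcases Nat.eq_zero_or_pos n with rfl | h₀
      · simp [r, pmStep]
      · rcases Nat.mod_two_eq_zero_or_one n with h | h <;>
          simp [r, h, h₀.ne', Nat.add_mod, pmStep]
    rw [hr]
    refine pmAccepts_of_period (k := 2) (i := 1) two_pos (fun n => by simp [r, Nat.add_mod])
      fun n => ?_
    simp only [r, Nat.add_eq_zero_iff, one_ne_zero, and_false, if_false]
    split_ifs <;> simp
  | one =>
    let r : ℕ → PMState := fun n => if n % 2 = 0 then .one else .lam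
    have hr : pmRun f .one (Stream'.const (g 1)) = r := by
      refine pmRun_eq_of_step (r := r) fun n => ?_
      rw [hconst]
      rcases Nat.mod_two_eq_zero_or_one n with h | h <;> simp [r, h, Nat.add_mod, pmStep]
    rw [hr]
    refine pmAccepts_of_period (k := 2) (i := 1) two_pos (fun n => by simp [r, Nat.add_mod])
      fun n => ?_
    simp only [r]
    split_ifs <;> simp

/-- The word `(0011)^ω`. From state `1` it runs through `1, 1, 1, λ` periodically, from state `λ`
through `λ, 0, λ, 1`. -/
def separatingWord (g : Fin 2 → A) : Stream' A :=
  fun n => if n % 4 < 2 then g 0 else g 1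

theorem map_separatingWord (hg : ∀ i, f (g i) = i) (n : ℕ) :
    f ((separatingWord g).get n) = if n % 4 < 2 then 0 else 1 := by
  change f (if n % 4 < 2 then g 0 else g 1) = _
  split_ifs <;> exact hg _

theorem pmAccepts_one_separatingWord (hg : ∀ i, f (g i) = i) :
    PMAccepts (pmRun f .one (separatingWord g)) := by
  let r : ℕ → PMState := fun n => if n % 4 = 3 then .lam else .one
  have hr : pmRun f .one (separatingWord g) = r := by
    refine pmRun_eq_of_step (r := r) fun n => ?_
    rw [map_separatingWord hg]
    have h : n % 4 = 0 ∨ n % 4 = 1 ∨ n % 4 = 2 ∨ n % 4 = 3 := by lia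
    rcases h with h | h | h | h <;> simp [r, h, Nat.add_mod, pmStep]
  rw [hr]
  refine pmAccepts_of_period (k := 4) (i := 3) four_pos (fun n => by simp [r, Nat.add_mod])
    fun n => ?_
  simp only [r]
  split_ifs <;> simp

theorem not_pmAccepts_lam_separatingWord (hg : ∀ i, f (g i) = i) :
    ¬ PMAccepts (pmRun f .lam (separatingWord g)) := by
  let r : ℕ → PMState := fun n =>
    if n % 4 = 1 then .zero else if n % 4 = 3 then .one else .lam
  have hr : pmRun f .lam (separatingWord g) = r := by
    refine pmRun_eq_of_step (r := r) fun n => ?_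
    rw [map_separatingWord hg]
    have h : n % 4 = 0 ∨ n % 4 = 1 ∨ n % 4 = 2 ∨ n % 4 = 3 := by lia
    rcases h with h | h | h | h <;> simp [r, h, Nat.add_mod, pmStep]
  rw [hr]
  exact fun h => h.2 (frequently_atTop.2 fun N => ⟨4 * N + 1, by lia, by simp [r, Nat.add_mod]⟩)

theorem pmAccepts_cons (q : PMState) (a : A) (z : Stream' A) :
    PMAccepts (pmRun f q (Stream'.cons a z)) ↔ PMAccepts (pmRun f (pmStep q (f a)) z) := by
  rw [← pmAccepts_comp_add _ 1]
  have h : pmRun f (pmStep q (f a)) z = fun n => pmRun f q (Stream'.cons a z) (n + 1) :=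
    pmRun_eq_of_step (r := fun n => pmRun f q (Stream'.cons a z) (n + 1)) fun _ => rfl
  rw [h]

/-- The three states accept pairwise different sets of infinite words: a first letter leads from
any two of them to the states `1` and `λ`, which the word `(0011)^ω` tells apart. -/
theorem pmState_eq_of_forall_pmAccepts_iff (hg : ∀ i, f (g i) = i) {p q : PMState}
    (h : ∀ z, PMAccepts (pmRun f p z) ↔ PMAccepts (pmRun f q z)) : p = q := by
  have h₁ := pmAccepts_one_separatingWord hg
  have h₂ := not_pmAccepts_lam_separatingWord hg
  have e := h (separatingWord g)
  have e₀ := h (Stream'.cons (g 0) (separatingWord g))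
  have e₁ := h (Stream'.cons (g 1) (separatingWord g))
  rw [pmAccepts_cons, pmAccepts_cons, hg] at e₀ e₁
  cases p <;> cases q <;> simp_all [pmStep]

theorem rightCongruence_pmLanguage_iff (hg : ∀ i, f (g i) = i) {x y : List A} :
    rightCongruence (pmLanguage f) x y ↔ pmState f x = pmState f y := by
  constructor
  · intro h
    refine pmState_eq_of_forall_pmAccepts_iff hg fun z => ?_
    rw [← append_mem_pmLanguage_iff, ← append_mem_pmLanguage_iff]
    exact h z
  · intro h z
    rw [append_mem_pmLanguage_iff, append_mem_pmLanguage_iff, h]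

theorem pmState_surjective (hg : ∀ i, f (g i) = i) : Function.Surjective (pmState f) := by
  intro q
  cases q with
  | lam => exact ⟨[], rfl⟩
  | zero => exact ⟨[g 0], by simp [pmState, hg, pmStep]⟩
  | one => exact ⟨[g 1], by simp [pmState, hg, pmStep]⟩

theorem nonempty_iso_pmPull (hg : ∀ i, f (g i) = i) :
    Nonempty (Iso (rightconAutomaton (pmLanguage f)) (pmPull f)) := by
  let φ : Quotient (rightCongruence (pmLanguage f)) → PMState :=
    Quotient.lift (pmState f) fun _ _ => (rightCongruence_pmLanguage_iff hg).1
  have hinj : Function.Injective φ := by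
    intro c d
    induction c, d using Quotient.inductionOn₂
    exact fun h => Quotient.sound ((rightCongruence_pmLanguage_iff hg).2 h)
  have hsurj : Function.Surjective φ := fun q =>
    (pmState_surjective hg q).imp' (Quotient.mk _) fun _ h => h
  refine ⟨⟨Equiv.ofBijective φ ⟨hinj, hsurj⟩, rfl, fun c a d => ?_⟩⟩
  rw [pmPull_step]
  induction c using Quotient.inductionOn with | _ x => ?_
  change d = Quotient.mk _ (x ++ [a]) ↔ φ d = pmStep (pmState f x) (f a)
  have h : pmStep (pmState f x) (f a) = φ (Quotient.mk _ (x ++ [a])) := by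
    change _ = pmState f (x ++ [a])
    simp [pmState]
  rw [h, hinj.eq_iff]

theorem pmLanguage_mem_IM (hg : ∀ i, f (g i) = i) : pmLanguage f ∈ IM A :=
  ⟨PMState, inferInstance, pmPull f, pmMuller, pmPull_deterministic f, rfl,
    nonempty_iso_pmPull hg⟩

theorem isColoring_pmColor : IsColoring pmColor :=
  ⟨4, fun q => by cases q <;> simp [pmColor]⟩

theorem pmLanguage_mem_IP (hg : ∀ i, f (g i) = i) : pmLanguage f ∈ IP A :=
  ⟨PMState, inferInstance, pmPull f, pmColor, pmPull_deterministic f, isColoring_pmColor,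
    pmLanguage_eq_parity.symm, nonempty_iso_pmPull hg⟩

/-- If the language were the limit of a set `p` of words, one could alternate between prefixes in
`p`, which exist because `1^ω` is accepted from every state, and visits to the state `0`. The
resulting word would be in the language although `0` recurs. -/
theorem pmLanguage_notMem_DB (hg : ∀ i, f (g i) = i) : pmLanguage f ∉ DB A := by
  intro hB
  obtain ⟨p, hp⟩ := exists_isLimitOf_of_mem_DB hB
  obtain ⟨x, hxp, hxq⟩ := exists_frequently_and_frequently (D := fun _ => True) (p := p)
    (q := fun z => pmState f z = .zero) (z₀ := []) trivial
    (fun z _ => exists_extension_of_frequently (fun _ => trivial) (take_length_append z _)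
      ((hp _).1 (append_mem_pmLanguage_iff.2 (pmAccepts_const hg _))))
    (fun z _ => by
      have key : ∀ v, v ≠ [] → pmState f (z ++ v) = .zero →
          ∃ t, True ∧ z <+: t ∧ z.length < t.length ∧ pmState f t = .zero := fun v hv h =>
        ⟨z ++ v, trivial, List.prefix_append z v, by
          simpa [List.length_pos_iff] using hv, h⟩
      have happ : ∀ v, pmState f (z ++ v) = v.foldl (fun q a => pmStep q (f a)) (pmState f z) :=
        fun v => List.foldl_append
      cases hz : pmState f z with
      | lam => exact key [g 0] (by simp) (by simp [happ, hz, hg, pmStep])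
      | zero => exact key [g 0, g 0] (by simp) (by simp [happ, hz, hg, pmStep])
      | one => exact key [g 1, g 0] (by simp) (by simp [happ, hz, hg, pmStep]))
  refine (mem_pmLanguage_iff.1 ((hp x).2 hxp)).2 ?_
  simpa only [pmRun_eq_pmState] using hxq

end WitnessStates

theorem exists_letterMap_with_section (A : Type u) [Nontrivial A] :
    ∃ (f : A → Fin 2) (g : Fin 2 → A), ∀ i, f (g i) = i := by
  classical
  obtain ⟨a, b, hab⟩ := exists_pair_ne A
  refine ⟨fun c => if c = a then 0 else 1, ![a, b], fun i => ?_⟩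
  fin_cases i
  · simp
  · simp [hab.symm]

/-! ### Strongly connected sets of the witness -/

theorem pmAutomaton_isSCC_of_center {S : Set PMState} {q : PMState} (hq : q ∈ S)
    (hto : ∀ s ∈ S, Relation.TransGen
      (fun p q => p ∈ S ∧ q ∈ S ∧ ∃ a, q ∈ pmAutomaton.step p a) s q)
    (hfrom : ∀ t ∈ S, Relation.TransGen
      (fun p q => p ∈ S ∧ q ∈ S ∧ ∃ a, q ∈ pmAutomaton.step p a) q t) :
    pmAutomaton.IsSCC S :=
  ⟨⟨q, hq⟩, fun s hs t ht => (hto s hs).trans (hfrom t ht)⟩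

theorem pmAutomaton_isSCC_one : pmAutomaton.IsSCC {.one} := by
  refine ⟨⟨.one, rfl⟩, ?_⟩
  rintro _ rfl _ rfl
  exact .single ⟨rfl, rfl, 0, rfl⟩

theorem pmAutomaton_isSCC_lam_one : pmAutomaton.IsSCC {.lam, .one} := by
  have hlam : PMState.lam ∈ ({.lam, .one} : Set PMState) := Or.inl rfl
  have hone : PMState.one ∈ ({.lam, .one} : Set PMState) := Or.inr rfl
  refine pmAutomaton_isSCC_of_center hone ?_ ?_
  · rintro _ (rfl | rfl)
    exacts [.single ⟨hlam, hone, 1, rfl⟩, .single ⟨hone, hone, 0, rfl⟩]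
  · rintro _ (rfl | rfl)
    exacts [.single ⟨hone, hlam, 1, rfl⟩, .single ⟨hone, hone, 0, rfl⟩]

theorem pmAutomaton_isSCC_univ : pmAutomaton.IsSCC Set.univ := by
  refine pmAutomaton_isSCC_of_center (q := .lam) trivial ?_ ?_
  · rintro (_ | _ | _) -
    · exact .tail (.single ⟨trivial, trivial, 0, rfl⟩)
        (⟨trivial, trivial, 0, rfl⟩ : PMState.zero ∈ Set.univ ∧ _)
    · exact .single ⟨trivial, trivial, 0, rfl⟩
    · exact .single ⟨trivial, trivial, 1, rfl⟩
  · rintro (_ | _ | _) -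
    · exact .tail (.single ⟨trivial, trivial, 0, rfl⟩)
        (⟨trivial, trivial, 0, rfl⟩ : PMState.zero ∈ Set.univ ∧ _)
    · exact .single ⟨trivial, trivial, 0, rfl⟩
    · exact .single ⟨trivial, trivial, 1, rfl⟩

theorem mainTheorem5 :
    -- inclusion, over every finite alphabet
    (∀ (A : Type*) [Finite A], DB A ∩ DC A ⊆ IM A ∧ DB A ∩ DC A ⊆ IP A) ∧
    -- strictness, over every finite alphabet with at least two letters
    (∀ (A : Type*) [Finite A] [Nontrivial A], DB A ∩ DC A ⊂ IM A ∧ DB A ∩ DC A ⊂ IP A) ∧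
    -- the three-state witness over `{0, 1}`
    (pmAutomaton.Deterministic ∧
      OmegaAutomaton.IsColoring pmColor ∧
      pmAutomaton.language (OmegaAutomaton.muller pmMuller) =
        pmAutomaton.language (OmegaAutomaton.parity pmColor) ∧
      Nonempty (OmegaAutomaton.Iso
        (rightconAutomaton (pmAutomaton.language (OmegaAutomaton.muller pmMuller)))
        pmAutomaton) ∧
      pmAutomaton.language (OmegaAutomaton.muller pmMuller) ∈ IM (Fin 2) ∩ IP (Fin 2) ∧
      pmAutomaton.language (OmegaAutomaton.muller pmMuller) ∉ DB (Fin 2) ∩ DC (Fin 2) ∧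
      -- an inclusion chain of SCCs: rejecting, accepting, rejecting
      (({.one} : Set PMState) ⊂ {.lam, .one} ∧ ({.lam, .one} : Set PMState) ⊂ Set.univ ∧
        pmAutomaton.IsSCC {.one} ∧ ({.one} : Set PMState) ∉ pmMuller ∧
        pmAutomaton.IsSCC {.lam, .one} ∧ ({.lam, .one} : Set PMState) ∈ pmMuller ∧
        pmAutomaton.IsSCC Set.univ ∧ (Set.univ : Set PMState) ∉ pmMuller)) := by

  have hid : ∀ i : Fin 2, id (id i) = i := fun _ => rfl
  have hzero : PMState.zero ∉ ({.lam, .one} : Set PMState) := by simp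
  refine ⟨fun A _ => ⟨DB_inter_DC_subset_IM A, DB_inter_DC_subset_IP A⟩, fun A _ _ => ?_,
    pmPull_deterministic id, isColoring_pmColor, pmLanguage_eq_parity (f := id),
    nonempty_iso_pmPull hid, ⟨pmLanguage_mem_IM hid, pmLanguage_mem_IP hid⟩,
    fun h => pmLanguage_notMem_DB hid h.1, ?_, ?_, pmAutomaton_isSCC_one, ?_,
    pmAutomaton_isSCC_lam_one, rfl, pmAutomaton_isSCC_univ, ?_⟩
  · obtain ⟨f, g, hg⟩ := exists_letterMap_with_section A
    exact ⟨⟨DB_inter_DC_subset_IM A,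
        fun h => pmLanguage_notMem_DB hg (h (pmLanguage_mem_IM hg)).1⟩,
      ⟨DB_inter_DC_subset_IP A, fun h => pmLanguage_notMem_DB hg (h (pmLanguage_mem_IP hg)).1⟩⟩
  · refine ⟨fun _ h => Or.inr h, fun h => ?_⟩
    have hlam : PMState.lam ∈ ({.one} : Set PMState) := h (Or.inl rfl)
    simp at hlam
  · exact ⟨Set.subset_univ _, fun h => hzero (h trivial)⟩
  · intro h
    have hlam : PMState.lam ∈ ({.one} : Set PMState) := Set.ext_iff.1 h _ |>.2 (Or.inl rfl)
    simp at hlam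
  · exact fun h => hzero ((Set.ext_iff.1 h _).1 trivial)
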